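/- Let $K$ be a field of characteristic $0$, let $e\ge 1$ be an integer, and let $R(t)\in K[[t]]$ be a power series (with coefficients not involving $q$) such that $R(0)\neq 0$. Define $$G_e(R)=\exp\Big[-\sum_{n,m,j>0} j\cdot\frac1m\,[z^{me+j}]\{R(z)^m\}\cdot\frac1n\,[z^{ne-j}]\{R(z)^n\}\;q^{n+m}\Big]\in K[[q]],$$ where $[z^k]$ denotes the coefficient of $z^k$ (which is $0$ for $k<0$). For a field extension $L/K$, a Newton--Puiseux solution over $L$ of the equation $$H^e=q\,R(H)$$ is a Puiseux series $H\in\bigcup_{d\ge1}L((q^{1/d}))$ of positive order in $q$ that satisfies it. If $L$ is algebraically closed, then there are exactly $e$ different Newton--Puiseux solutions over $L$. For any field extension $L/K$ over which there are $e$ different Newton--Puiseux solutions $H_1,\dots,H_e$, the identity $$G_e(R)=\prod_{i=1}^e\frac{R(H_i)}{R(0)}\cdot\prod_{i=1}^e H_i^{e}\cdot\prod_{i_1\neq i_2}\frac{1}{H_{i_2}-H_{i_1}}\cdot\prod_{i=1}^e\Big(\frac{e}{H_i}-\frac{R'(H_i)}{R(H_i)}\Big)$$ holds in the field of Puiseux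 series over $L$, where the third product runs over all ordered pairs $(i_1,i_2)$ with $1\le i_1,i_2\le e$ and $i_1\ne i_2$. -/

import Mathlib

noncomputable section

namespace NewtonPuiseux

open PowerSeries

/-- The power series in `q` (the variable of the result)
`∑_{n, m, j > 0} j · (1/m) [z^{me+j}] R^m · (1/n) [z^{ne-j}] R^n · q^{n+m}`.
For `j > n e` the exponent `ne - j` is negative and the coefficient `[z^{ne-j}] R^n` is zero, so
that the sum over `j` runs over `1 ≤ j ≤ n e`, and the coefficient of each `q^N` is a finite sum. -/
def exponentSeries {K : Type*} [Field K] (e : ℕ) (R : K⟦X⟧) : K⟦X⟧ :=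
  PowerSeries.mk fun N =>
    ∑ p ∈ (Finset.HasAntidiagonal.antidiagonal N).filter (fun p => 0 < p.1 ∧ 0 < p.2),
      ∑ j ∈ Finset.Icc 1 (p.1 * e),
        (j : K) * ((1 / (p.2 : K)) * coeff (p.2 * e + j) (R ^ p.2)) *
          ((1 / (p.1 : K)) * coeff (p.1 * e - j) (R ^ p.1))

/-- The exponent has no constant term, so it may be substituted into the exponential series. -/
theorem hasSubst_neg_exponentSeries {K : Type*} [Field K] (e : ℕ) (R : K⟦X⟧) :
    PowerSeries.HasSubst (-exponentSeries e R) := by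
  apply PowerSeries.HasSubst.of_constantCoeff_zero'
  rw [map_neg, neg_eq_zero, ← PowerSeries.coeff_zero_eq_constantCoeff_apply]
  simp [exponentSeries, Finset.filter_singleton]

/-- `G_e(R) = exp (-∑_{n, m, j > 0} …)`, a power series in `q` with coefficients in `K`. -/
def G {K : Type*} [Field K] [CharZero K] (e : ℕ) (R : K⟦X⟧) : K⟦X⟧ :=
  (PowerSeries.exp K).subst (-exponentSeries e R)

/-- A Hahn series in `q` with rational exponents is a (Newton–)Puiseux series if its exponents
have a common denominator `d > 0`. (They are bounded below, as the support is well-ordered.) -/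
def IsPuiseux {L : Type*} [Field L] (H : HahnSeries ℚ L) : Prop :=
  ∃ d : ℕ, 0 < d ∧ ∀ a ∈ H.support, ∃ k : ℤ, a = (k : ℚ) / (d : ℚ)

/-- A power series `f` over `K` evaluated at a Hahn series `H` over an extension `L` of `K`;
this is `∑ n, f_n H^n` if `H` has positive order, the only case in which it is used. -/
def evalAt {K L : Type*} [Field K] [Field L] [Algebra K L] (f : K⟦X⟧) (H : HahnSeries ℚ L) :
    HahnSeries ℚ L :=
  PowerSeries.heval H (PowerSeries.map (algebraMap K L) f)

/-- A power series in `q` over `K`, seen as a series with rational exponents over `L`. -/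
def toHahn {K : Type*} (L : Type*) [Field K] [Field L] [Algebra K L] (f : K⟦X⟧) :
    HahnSeries ℚ L :=
  HahnSeries.ofPowerSeries ℚ L (PowerSeries.map (algebraMap K L) f)

/-- The Newton–Puiseux solutions over `L` of `H^e = q R(H)`: the Puiseux series `H` in `q` of
positive order (so that `R(H)` makes sense) that satisfy the equation. -/
def solutions {K : Type*} (L : Type*) [Field K] [Field L] [Algebra K L] (e : ℕ) (R : K⟦X⟧) :
    Set (HahnSeries ℚ L) :=
  {H | IsPuiseux H ∧ 0 < H.orderTop ∧ H ^ e = HahnSeries.single (1 : ℚ) (1 : L) * evalAt R H}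

end NewtonPuiseux

end

/-!
Write `R = r ρ ^ e` with `r = R(0)` and `ρ(0) = 1`, and let `ψ(x) = x σ(x)` be the compositional
inverse of `z / ρ(z)`. The solutions of `H ^ e = q R(H)` are `H_i = ψ(c_i s)`, where `s = q^{1/e}`
and the `c_i` are the `e`-th roots of `r`.

Let `P(x, z)` be the part of positive degree in `z` of `-log (1 - x ρ(z) / z)`. By Lagrange
inversion, `z - x ρ(z) = exp (-P(x, z)) · (z - ψ(x)) · x / ψ(x)`, and the substitution `z = ψ(y)`
turns this into `exp (-P(x, ψ(y))) = σ(x) σ(y) (y - x) / (ψ(y) - ψ(x))`. By Lagrange inversion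
once more, `P(x, ψ(y)) = ∑ j · (1/n) [z^{n+j}] ρ^n · (1/m) [z^{m-j}] ρ^m · x^n y^m`. In the
product of this identity over all `x = c_i s`, `y = c_j s` the left side becomes `G_e(R)`, because
the power sums of the `c_i` vanish except in degrees divisible by `e`. On the right side the terms
`i ≠ j` contribute the differences `H_j - H_i`, and the terms `i = j` contribute the derivatives
`ψ'(c_i s)`, which differentiating the equation identifies through
`e / H_i - R'(H_i) / R(H_i) = e / (c_i s ψ'(c_i s))`.
-/

namespace NewtonPuiseux

open PowerSeries
open Finset.HasAntidiagonal (antidiagonal mem_antidiagonal)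

section Substitution

variable {A B : Type*} [CommRing A] [CommRing B]

theorem hasSubst_X_mul (u : A⟦X⟧) : HasSubst (X * u : A⟦X⟧) :=
  HasSubst.of_constantCoeff_zero' (by simp)

theorem coeff_one_X_mul (f : A⟦X⟧) : coeff 1 (X * f) = constantCoeff f := by
  rw [← zero_add 1, coeff_succ_X_mul, coeff_zero_eq_constantCoeff_apply]

theorem subst_X_mul_eq_trunc_add (f u : A⟦X⟧) (N : ℕ) :
    f.subst (X * u) = ∑ k ∈ Finset.range N, C (coeff k f) * (X * u) ^ k +
      (X * u) ^ N * (mk fun i => coeff (i + N) f).subst (X * u) := by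
  have hs := hasSubst_X_mul u
  have htrunc : (trunc N f : A⟦X⟧).subst (X * u) =
      ∑ k ∈ Finset.range N, C (coeff k f) * (X * u) ^ k := by
    rw [subst_coe hs, trunc_apply, Nat.Ico_zero_eq_range, map_sum]
    exact Finset.sum_congr rfl fun k _ => Polynomial.aeval_monomial _
  conv_lhs => rw [eq_X_pow_mul_shift_add_trunc N f]
  rw [subst_add hs, subst_mul hs, subst_pow hs, subst_X hs, htrunc, add_comm]

theorem coeff_subst_X_mul_mul (f u w : A⟦X⟧) (n : ℕ) :
    coeff n (f.subst (X * u) * w) =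
      ∑ p ∈ antidiagonal n, coeff p.1 f * coeff p.2 (u ^ p.1 * w) := by
  rw [subst_X_mul_eq_trunc_add f u (n + 1), add_mul, map_add, mul_pow _ _ (n + 1), mul_assoc,
    mul_assoc, coeff_X_pow_mul', if_neg (by lia), add_zero, Finset.sum_mul, map_sum,
    Finset.Nat.sum_antidiagonal_eq_sum_range_succ_mk]
  refine Finset.sum_congr rfl fun k hk => ?_
  rw [mul_pow, mul_assoc, mul_assoc, coeff_C_mul, coeff_X_pow_mul',
    if_pos (Nat.lt_succ_iff.1 (Finset.mem_range.1 hk))]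

theorem coeff_subst_X_mul (f u : A⟦X⟧) (n : ℕ) :
    coeff n (f.subst (X * u)) = ∑ p ∈ antidiagonal n, coeff p.1 f * coeff p.2 (u ^ p.1) := by
  simpa only [mul_one] using coeff_subst_X_mul_mul f u 1 n

theorem constantCoeff_subst_of_constantCoeff_eq_zero (f : A⟦X⟧) {g : A⟦X⟧}
    (hg : constantCoeff g = 0) : constantCoeff (f.subst g : A⟦X⟧) = constantCoeff f := by
  obtain ⟨u, rfl⟩ := X_dvd_iff.2 hg
  rw [← coeff_zero_eq_constantCoeff_apply, coeff_subst_X_mul]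
  simp

/-- Substitution of `X * u` as a ring endomorphism of the power series ring. -/
noncomputable def substXMul (u : A⟦X⟧) : A⟦X⟧ →+* A⟦X⟧ :=
  (substAlgHom (R := A) (hasSubst_X_mul u)).toRingHom

theorem substXMul_apply (u f : A⟦X⟧) : substXMul u f = f.subst (X * u) :=
  congrFun (coe_substAlgHom (hasSubst_X_mul u)) f

theorem substXMul_C (u : A⟦X⟧) (a : A) : substXMul u (C a) = C a :=
  (substXMul_apply u _).trans (subst_C a)

/- The hypothesis `X ∣ Φ X` makes `Φ` continuous for the `X`-adic topologies. -/
theorem map_subst_of_X_dvd (Φ : A⟦X⟧ →+* B⟦X⟧) (hΦ : X ∣ Φ X) {f g : A⟦X⟧} {f' : B⟦X⟧}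
    (hf : ∀ n, Φ (C (coeff n f)) = C (coeff n f')) (hg : constantCoeff g = 0) :
    Φ (f.subst g) = f'.subst (Φ g) := by
  obtain ⟨t, ht⟩ := hΦ
  obtain ⟨u, rfl⟩ := X_dvd_iff.2 hg
  have hΦu : Φ (X * u) = X * (t * Φ u) := by rw [map_mul, ht, mul_assoc]
  ext n
  have hn : ¬ n + 1 ≤ n := by lia
  rw [subst_X_mul_eq_trunc_add f u (n + 1), map_add, map_mul, map_pow, hΦu,
    subst_X_mul_eq_trunc_add f' _ (n + 1), map_add, map_add, mul_pow _ _ (n + 1), mul_assoc,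
    mul_assoc, coeff_X_pow_mul', coeff_X_pow_mul', if_neg hn, if_neg hn]
  simp only [map_sum, map_mul, map_pow, hf, ht, mul_assoc]

end Substitution

section Derivative

variable {A B : Type*} [CommRing A] [CommRing B]

theorem derivative_mul (f g : A⟦X⟧) : d⁄dX A (f * g) = f * d⁄dX A g + g * d⁄dX A f :=
  (d⁄dX A).leibniz f g

theorem derivative_X_mul (f : A⟦X⟧) : d⁄dX A (X * f) = f + X * d⁄dX A f := by
  rw [derivative_mul, derivative_X, mul_one, add_comm]

theorem constantCoeff_derivative_X_mul (f : A⟦X⟧) :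
    constantCoeff (d⁄dX A (X * f)) = constantCoeff f := by
  rw [derivative_X_mul, map_add, map_mul, constantCoeff_X, zero_mul, add_zero]

theorem derivative_rescale (a : A) (f : A⟦X⟧) :
    d⁄dX A (rescale a f) = C a * rescale a (d⁄dX A f) := by
  ext n
  simp only [coeff_derivative, coeff_rescale, coeff_C_mul]
  ring

theorem constantCoeff_map (φ : A →+* B) (f : A⟦X⟧) :
    constantCoeff (map φ f) = φ (constantCoeff f) := by
  rw [← coeff_zero_eq_constantCoeff_apply, coeff_map, coeff_zero_eq_constantCoeff_apply]

theorem derivative_map (φ : A →+* B) (f : A⟦X⟧) : d⁄dX B (map φ f) = map φ (d⁄dX A f) := by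
  ext n
  simp [coeff_derivative]

theorem rescale_C (a b : A) : rescale a (C b) = C b := by
  ext n
  rw [coeff_rescale, coeff_C]
  split_ifs with hn <;> simp [hn]

theorem derivative_mul_of_logDeriv {f g u v : A⟦X⟧} (hf : d⁄dX A f = u * f)
    (hg : d⁄dX A g = v * g) : d⁄dX A (f * g) = (u + v) * (f * g) := by
  rw [derivative_mul, hf, hg]
  ring

theorem eq_zero_of_derivative_eq_mul [IsAddTorsionFree A] {f u : A⟦X⟧}
    (hf : d⁄dX A f = u * f) (h0 : constantCoeff f = 0) : f = 0 := by
  ext n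
  induction n using Nat.strong_induction_on with
  | _ n ih =>
    cases n with
    | zero => simpa using h0
    | succ n =>
      have h := congrArg (coeff n) hf
      rw [coeff_derivative, coeff_mul, Finset.sum_eq_zero fun p hp => by
        rw [ih p.2 (by have := mem_antidiagonal.1 hp; lia), map_zero, mul_zero]] at h
      have hsmul : (n + 1) • coeff (n + 1) f = 0 := by
        rw [nsmul_eq_mul, mul_comm]
        exact_mod_cast h
      simpa using (smul_eq_zero_iff_right n.succ_ne_zero).1 hsmul

theorem eq_of_derivative_eq_mul [IsAddTorsionFree A] {f g u : A⟦X⟧}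
    (hf : d⁄dX A f = u * f) (hg : d⁄dX A g = u * g)
    (h0 : constantCoeff f = constantCoeff g) : f = g := by
  refine sub_eq_zero.1 (eq_zero_of_derivative_eq_mul (u := u) ?_ ?_)
  · rw [map_sub, hf, hg, mul_sub]
  · rw [map_sub, h0, sub_self]

end Derivative

section Exponential

variable {A : Type*} [CommRing A] [Algebra ℚ A]

theorem derivative_exp_subst {g : A⟦X⟧} (hg : constantCoeff g = 0) :
    d⁄dX A ((exp A).subst g) = d⁄dX A g * (exp A).subst g := by
  rw [derivative_subst (HasSubst.of_constantCoeff_zero' hg), derivative_exp, mul_comm]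

theorem constantCoeff_exp_subst {g : A⟦X⟧} (hg : constantCoeff g = 0) :
    constantCoeff ((exp A).subst g : A⟦X⟧) = 1 := by
  rw [constantCoeff_subst_of_constantCoeff_eq_zero _ hg, constantCoeff_exp]

theorem exp_subst_add {g h : A⟦X⟧} (hg : constantCoeff g = 0) (hh : constantCoeff h = 0) :
    (exp A).subst (g + h) = (exp A).subst g * (exp A).subst h := by
  have : IsAddTorsionFree A := IsAddTorsionFree.of_module_rat A
  have hgh : constantCoeff (g + h) = 0 := by rw [map_add, hg, hh, add_zero]
  refine eq_of_derivative_eq_mul (derivative_exp_subst hgh) ?_ ?_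
  · rw [map_add]
    exact derivative_mul_of_logDeriv (derivative_exp_subst hg) (derivative_exp_subst hh)
  · rw [map_mul, constantCoeff_exp_subst hgh, constantCoeff_exp_subst hg,
      constantCoeff_exp_subst hh, one_mul]

theorem exp_subst_sum {ι : Type*} (s : Finset ι) {g : ι → A⟦X⟧}
    (hg : ∀ i ∈ s, constantCoeff (g i) = 0) :
    (exp A).subst (∑ i ∈ s, g i) = ∏ i ∈ s, (exp A).subst (g i) := by
  classical
  induction s using Finset.induction_on with
  | empty => simp [subst_zero_eq_C_constantCoeff]
  | insert i s hi ih =>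
    rw [Finset.forall_mem_insert] at hg
    rw [Finset.sum_insert hi, Finset.prod_insert hi, exp_subst_add hg.1, ih hg.2]
    rw [map_sum]
    exact Finset.sum_eq_zero hg.2

theorem map_exp_subst {B : Type*} [CommRing B] [Algebra ℚ B] (Φ : A⟦X⟧ →+* B⟦X⟧)
    (hΦ : X ∣ Φ X) {g : A⟦X⟧} (hg : constantCoeff g = 0) :
    Φ ((exp A).subst g) = (exp B).subst (Φ g) := by
  refine map_subst_of_X_dvd Φ hΦ (fun n => ?_) hg
  rw [coeff_exp, coeff_exp]
  exact (RingHom.map_rat_algebraMap (Φ.comp C) _).trans (RingHom.map_rat_algebraMap C _).symm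

end Exponential

section Root

variable {A : Type*} [CommRing A] [Algebra ℚ A]

theorem binomialSeries_pow (r : ℚ) (n : ℕ) :
    binomialSeries A r ^ n = binomialSeries A (n * r) := by
  induction n with
  | zero => simp
  | succ n ih => rw [pow_succ, ih, ← binomialSeries_add, Nat.cast_succ, add_one_mul]

theorem exists_pow_eq_of_constantCoeff_eq_one {e : ℕ} (he : e ≠ 0) {f : A⟦X⟧}
    (hf : constantCoeff f = 1) : ∃ ρ : A⟦X⟧, ρ ^ e = f ∧ constantCoeff ρ = 1 := by
  have hf' : constantCoeff (f - 1) = 0 := by rw [map_sub, hf, map_one, sub_self]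
  have hs : HasSubst (f - 1) := HasSubst.of_constantCoeff_zero' hf'
  refine ⟨(binomialSeries A (e : ℚ)⁻¹).subst (f - 1), ?_, ?_⟩
  · have hone : binomialSeries A (1 : ℚ) = 1 + X := by
      simpa using binomialSeries_nat (R := ℚ) (A := A) 1
    rw [← subst_pow hs, binomialSeries_pow, mul_inv_cancel₀ (Nat.cast_ne_zero.2 he), hone,
      subst_add hs, subst_X hs, ← coe_substAlgHom hs, map_one, add_sub_cancel]
  · rw [constantCoeff_subst_of_constantCoeff_eq_zero _ hf', binomialSeries_constantCoeff]

end Root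

section LagrangeInversion

variable {K : Type*} [Field K] {ρ σ : K⟦X⟧}

theorem constantCoeff_eq_of_subst_eq (h : ρ.subst (X * σ) = σ) :
    constantCoeff ρ = constantCoeff σ := by
  rw [← constantCoeff_subst_of_constantCoeff_eq_zero ρ (g := X * σ) (by simp), h]

theorem inv_pow_mul_pow (hσ : constantCoeff σ ≠ 0) (n : ℕ) : σ⁻¹ ^ n * σ ^ n = 1 := by
  rw [← mul_pow, PowerSeries.inv_mul_cancel σ hσ, one_pow]

theorem exists_subst_X_mul_eq (hρ : constantCoeff ρ ≠ 0) :
    ∃ σ : K⟦X⟧, ρ.subst (X * σ) = σ ∧ (X * σ).subst (X * ρ⁻¹) = X := by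
  have hunit : IsUnit (coeff 1 (X * ρ⁻¹)) := by
    rw [coeff_one_X_mul, constantCoeff_inv]
    exact (inv_ne_zero hρ).isUnit
  have h0 : constantCoeff (X * ρ⁻¹) = 0 := by simp
  obtain ⟨σ, hσ⟩ := X_dvd_iff.2 (constantCoeff_substInvOfIsUnit (X * ρ⁻¹) hunit)
  have hs := hasSubst_X_mul σ
  have hright := subst_substInvOfIsUnit_right (X * ρ⁻¹) h0 hunit
  have hleft := subst_substInvOfIsUnit_left (X * ρ⁻¹) h0 hunit
  rw [hσ] at hright hleft
  refine ⟨σ, ?_, hleft⟩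
  have hρinv : ρ.subst (X * σ) * ρ⁻¹.subst (X * σ) = (1 : K⟦X⟧) := by
    rw [← subst_mul hs, PowerSeries.mul_inv_cancel ρ hρ, ← coe_substAlgHom hs, map_one]
  have hσinv : σ * ρ⁻¹.subst (X * σ) = 1 := by
    rw [subst_mul hs, subst_X hs, mul_assoc] at hright
    exact mul_left_cancel₀ X_ne_zero (hright.trans (mul_one X).symm)
  exact mul_right_cancel₀ (right_ne_zero_of_mul_eq_one hσinv) (hρinv.trans hσinv.symm)

variable [CharZero K]

/- For `M > 0` the series is, up to the unit `-M`, the derivative of the Laurent series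
`(X * σ) ^ (-M)`, which has no residue. -/
theorem coeff_inv_pow_mul_derivative (hσ : constantCoeff σ ≠ 0) (M : ℕ) :
    coeff M (σ⁻¹ ^ (M + 1) * d⁄dX K (X * σ)) = if M = 0 then 1 else 0 := by
  have hinv : σ⁻¹ * σ = 1 := PowerSeries.inv_mul_cancel σ hσ
  rw [derivative_X_mul]
  cases M with
  | zero => simp [hσ]
  | succ M =>
    have hsplit : σ⁻¹ ^ (M + 1 + 1) * (σ + X * d⁄dX K σ) =
        σ⁻¹ ^ (M + 1) + X * (σ⁻¹ ^ (M + 1 + 1) * d⁄dX K σ) := by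
      linear_combination σ⁻¹ ^ (M + 1) * hinv
    have hderiv : d⁄dX K (σ⁻¹ ^ (M + 1)) =
        -(C ((M : K) + 1) * (σ⁻¹ ^ (M + 1 + 1) * d⁄dX K σ)) := by
      rw [derivative_pow, derivative_inv', Nat.add_sub_cancel]
      push_cast
      rw [map_add, map_natCast, map_one]
      ring
    have hcoeff := congrArg (coeff M) hderiv
    rw [coeff_derivative, map_neg, coeff_C_mul] at hcoeff
    rw [hsplit, map_add, coeff_succ_X_mul, if_neg M.succ_ne_zero]
    apply mul_left_cancel₀ (Nat.cast_add_one_ne_zero M : (M : K) + 1 ≠ 0)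
    linear_combination hcoeff

/- The change of variables formula for formal residues. -/
theorem coeff_subst_mul_inv_pow_mul_derivative (hσ : constantCoeff σ ≠ 0) (f : K⟦X⟧) (n : ℕ) :
    coeff n (f.subst (X * σ) * (σ⁻¹ ^ (n + 1) * d⁄dX K (X * σ))) = coeff n f := by
  rw [coeff_subst_X_mul_mul, Finset.sum_eq_single (n, 0)]
  · have hcancel : σ ^ n * (σ⁻¹ ^ (n + 1) * d⁄dX K (X * σ)) = σ⁻¹ ^ (0 + 1) * d⁄dX K (X * σ) := by
      linear_combination σ⁻¹ * d⁄dX K (X * σ) * inv_pow_mul_pow hσ n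
    rw [hcancel, coeff_inv_pow_mul_derivative hσ, if_pos rfl, mul_one]
  · rintro ⟨k, m⟩ hkm hne
    obtain rfl := mem_antidiagonal.1 hkm
    have hcancel : σ ^ k * (σ⁻¹ ^ (k + m + 1) * d⁄dX K (X * σ)) =
        σ⁻¹ ^ (m + 1) * d⁄dX K (X * σ) := by
      linear_combination σ⁻¹ ^ (m + 1) * d⁄dX K (X * σ) * inv_pow_mul_pow hσ k
    have hm : m ≠ 0 := by
      rintro rfl
      exact hne (by simp)
    rw [hcancel, coeff_inv_pow_mul_derivative hσ, if_neg hm, mul_zero]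
  · simp

theorem coeff_pow_add_add_one (hσ : constantCoeff σ ≠ 0) (h : ρ.subst (X * σ) = σ) (m k : ℕ) :
    coeff m (ρ ^ (m + k + 1)) = coeff m (σ ^ k * d⁄dX K (X * σ)) := by
  rw [← coeff_subst_mul_inv_pow_mul_derivative hσ, subst_pow (hasSubst_X_mul σ), h]
  congr 1
  linear_combination σ ^ k * d⁄dX K (X * σ) * inv_pow_mul_pow hσ (m + 1)

theorem coeff_pow_self (hσ : constantCoeff σ ≠ 0) (h : ρ.subst (X * σ) = σ) (m : ℕ) :
    coeff (m + 1) (ρ ^ (m + 1)) = coeff m (σ⁻¹ * d⁄dX K σ) := by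
  rw [← coeff_subst_mul_inv_pow_mul_derivative hσ, subst_pow (hasSubst_X_mul σ), h,
    derivative_X_mul]
  have hsplit : σ ^ (m + 1) * (σ⁻¹ ^ (m + 1 + 1) * (σ + X * d⁄dX K σ)) =
      1 + X * (σ⁻¹ * d⁄dX K σ) := by
    linear_combination σ⁻¹ * (σ + X * d⁄dX K σ) * inv_pow_mul_pow hσ (m + 1) +
      PowerSeries.inv_mul_cancel σ hσ
  rw [hsplit, map_add, coeff_succ_X_mul, coeff_one, if_neg m.succ_ne_zero, zero_add]

theorem lagrange_inversion (hσ : constantCoeff σ ≠ 0) (h : ρ.subst (X * σ) = σ) (k m : ℕ) :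
    ((k + m : ℕ) : K) * coeff m (σ ^ k) = k * coeff m (ρ ^ (k + m)) := by
  cases k with
  | zero => cases m <;> simp [coeff_one]
  | succ k =>
    have hderiv : d⁄dX K ((X * σ) ^ (k + 1)) =
        C ((k + 1 : ℕ) : K) * (X ^ k * (σ ^ k * d⁄dX K (X * σ))) := by
      rw [derivative_pow, Nat.add_sub_cancel, map_natCast]
      ring
    have hcoeff := congrArg (coeff (m + k)) hderiv
    rw [coeff_derivative, coeff_C_mul, coeff_X_pow_mul', if_pos (by lia), Nat.add_sub_cancel,
      ← coeff_pow_add_add_one hσ h, mul_pow, add_assoc, coeff_X_pow_mul', if_pos (by lia),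
      Nat.add_sub_cancel] at hcoeff
    rw [add_comm (k + 1), ← hcoeff]
    push_cast
    ring

end LagrangeInversion

section Factorization

variable {K : Type*} [Field K]

/-- The part of positive degree of the Laurent series `(ρ(z) / z) ^ n`. -/
noncomputable def posPart (ρ : K⟦X⟧) (n : ℕ) : K⟦X⟧ :=
  mk fun j => if j = 0 then 0 else coeff (n + j) (ρ ^ n)

/-- The part of positive degree in `z` of `-log (1 - x ρ(z) / z)`, as a power series in the outer
variable `x` over the power series in the inner variable `z`. -/
noncomputable def posLog (ρ : K⟦X⟧) : K⟦X⟧⟦X⟧ :=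
  mk fun n => C ((n : K)⁻¹) * posPart ρ n

theorem constantCoeff_neg_posLog (ρ : K⟦X⟧) : constantCoeff (-posLog ρ) = 0 := by
  rw [map_neg, neg_eq_zero, ← coeff_zero_eq_constantCoeff_apply, posLog, coeff_mk]
  simp

theorem coeff_rescale_X_map_C (f : K⟦X⟧) (n : ℕ) :
    coeff n (rescale (X : K⟦X⟧) (map C f)) = C (coeff n f) * X ^ n := by
  rw [coeff_rescale, coeff_map, mul_comm]

theorem exists_mul_one_sub_X_mul_eq {A : Type*} [CommRing A] (S P : A⟦X⟧) :
    ∃ N : A⟦X⟧, N * (1 - X * S) = P ∧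
      ∀ n, coeff n N = ∑ k ∈ Finset.range (n + 1), coeff (n - k) (S ^ k * P) := by
  have hunit : IsUnit (1 - X * S) := by simp [isUnit_iff_constantCoeff]
  obtain ⟨N, hN⟩ : ∃ N, N * (1 - X * S) = P :=
    ⟨P * ↑hunit.unit⁻¹, by rw [mul_assoc, hunit.val_inv_mul, mul_one]⟩
  refine ⟨N, hN, fun n => ?_⟩
  have hgeom : N = (∑ k ∈ Finset.range (n + 1), (X * S) ^ k) * P +
      X ^ (n + 1) * (S ^ (n + 1) * N) := by
    rw [← hN]
    linear_combination (-N) * geom_sum_mul_neg (X * S) (n + 1)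
  conv_lhs => rw [hgeom]
  rw [map_add, coeff_X_pow_mul', if_neg (by lia), add_zero, Finset.sum_mul, map_sum]
  refine Finset.sum_congr rfl fun k hk => ?_
  rw [mul_pow, mul_assoc, coeff_X_pow_mul', if_pos (Nat.lt_succ_iff.1 (Finset.mem_range.1 hk))]

variable [CharZero K] {ρ σ : K⟦X⟧}

theorem coeff_derivative_posLog (ρ : K⟦X⟧) (n : ℕ) :
    coeff n (d⁄dX K⟦X⟧ (posLog ρ)) = posPart ρ (n + 1) := by
  have hcast : ((n : K⟦X⟧) + 1) = C ((n + 1 : ℕ) : K) := by simp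
  rw [coeff_derivative, posLog, coeff_mk, hcast, mul_right_comm, ← map_mul,
    inv_mul_cancel₀ (Nat.cast_ne_zero.2 n.succ_ne_zero), map_one, one_mul]

theorem pow_eq_posPart_add (hσ : constantCoeff σ ≠ 0) (h : ρ.subst (X * σ) = σ) (n : ℕ) :
    ρ ^ (n + 1) = X ^ (n + 1) * posPart ρ (n + 1) + C (coeff n (σ⁻¹ * d⁄dX K σ)) * X ^ (n + 1) +
      ∑ k ∈ Finset.range (n + 1), C (coeff (n - k) (σ ^ k * d⁄dX K (X * σ))) * X ^ (n - k) := by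
  ext m
  simp only [map_add, map_sum, coeff_C_mul, coeff_X_pow_mul', coeff_X_pow]
  rcases lt_trichotomy m (n + 1) with hm | rfl | hm
  · obtain ⟨k, rfl⟩ := Nat.exists_eq_add_of_le (Nat.lt_succ_iff.1 hm)
    rw [if_neg (by lia), if_neg (by lia), Finset.sum_eq_single k]
    · simp [coeff_pow_add_add_one hσ h]
    · intro i hi hik
      have := Finset.mem_range.1 hi
      rw [if_neg (by lia), mul_zero]
    · intro hk
      exact absurd (Finset.mem_range.2 (by lia)) hk
  · rw [if_pos le_rfl, if_pos rfl, Finset.sum_eq_zero, coeff_pow_self hσ h]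
    · simp [posPart]
    · intro k _
      rw [if_neg (by lia), mul_zero]
  · obtain ⟨j, rfl⟩ := Nat.exists_eq_add_of_lt hm
    rw [if_pos hm.le, if_neg (by lia), Finset.sum_eq_zero, posPart, coeff_mk, if_neg (by lia)]
    · rw [Nat.add_sub_of_le hm.le]
      ring
    · intro k _
      rw [if_neg (by lia), mul_zero]

/- Comparing logarithmic derivatives in `x` of `z - x ρ(z) = exp (-posLog ρ) (z - ψ(x)) x / ψ(x)`,
where `ψ = X * σ`; the substitution `x ↦ x z` avoids the denominators in `z`. -/
theorem exists_logDeriv_add_eq_sub (hσ : constantCoeff σ ≠ 0) (h : ρ.subst (X * σ) = σ) :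
    ∃ F N : K⟦X⟧⟦X⟧, F * (1 - X * C ρ) = C ρ ∧
      N * (1 - X * rescale X (map C σ)) = rescale X (map C (d⁄dX K (X * σ))) ∧
      C X * rescale X (d⁄dX K⟦X⟧ (posLog ρ)) + N =
        F - C X * rescale X (map C (σ⁻¹ * d⁄dX K σ)) := by
  obtain ⟨F, hF, hFcoeff⟩ := exists_mul_one_sub_X_mul_eq (C ρ) (C ρ)
  obtain ⟨N, hN, hNcoeff⟩ := exists_mul_one_sub_X_mul_eq
    (rescale (X : K⟦X⟧) (map C σ)) (rescale X (map C (d⁄dX K (X * σ))))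
  refine ⟨F, N, hF, hN, ?_⟩
  rw [eq_sub_iff_add_eq]
  ext1 n
  have hFn : coeff n F = ρ ^ (n + 1) := by
    rw [hFcoeff, Finset.sum_eq_single_of_mem n (Finset.self_mem_range_succ n)]
    · rw [Nat.sub_self, ← pow_succ, ← map_pow, coeff_zero_C]
    · intro k hk hkn
      have := Finset.mem_range.1 hk
      rw [← pow_succ, ← map_pow, coeff_C, if_neg (by lia)]
  have hNn : coeff n N = ∑ k ∈ Finset.range (n + 1),
      C (coeff (n - k) (σ ^ k * d⁄dX K (X * σ))) * X ^ (n - k) := by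
    rw [hNcoeff]
    refine Finset.sum_congr rfl fun k _ => ?_
    rw [← map_pow, ← map_pow, ← map_mul, ← map_mul, coeff_rescale_X_map_C]
  rw [map_add, map_add, coeff_C_mul, coeff_C_mul, coeff_rescale, coeff_derivative_posLog,
    coeff_rescale_X_map_C, hFn, hNn, pow_eq_posPart_add hσ h]
  ring

theorem rescale_exp_posLog_mul (hσ : constantCoeff σ = 1) (h : ρ.subst (X * σ) = σ) :
    rescale X ((exp K⟦X⟧).subst (-posLog ρ)) * (1 - X * rescale X (map C σ)) =
      (1 - X * C ρ) * rescale (X : K⟦X⟧) (map C σ) := by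
  have : IsAddTorsionFree K⟦X⟧ := IsAddTorsionFree.of_module_rat _
  have hσ0 : constantCoeff σ ≠ 0 := hσ ▸ one_ne_zero
  obtain ⟨F, N, hF, hN, hFN⟩ := exists_logDeriv_add_eq_sub hσ0 h
  set γ := C X * rescale (X : K⟦X⟧) (d⁄dX K⟦X⟧ (posLog ρ))
  set Z := C X * rescale (X : K⟦X⟧) (map C (σ⁻¹ * d⁄dX K σ))
  set E := rescale (X : K⟦X⟧) ((exp K⟦X⟧).subst (-posLog ρ)) with hE
  set S := rescale (X : K⟦X⟧) (map C σ) with hS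
  have hE' : d⁄dX K⟦X⟧ E = -γ * E := by
    rw [hE, derivative_rescale, derivative_exp_subst (constantCoeff_neg_posLog ρ), map_mul,
      map_neg, map_neg]
    ring
  have hS' : d⁄dX K⟦X⟧ S = Z * S := by
    rw [hS, derivative_rescale, derivative_map, mul_assoc, ← map_mul, ← map_mul, mul_right_comm,
      PowerSeries.inv_mul_cancel σ hσ0, one_mul]
  have honeS : d⁄dX K⟦X⟧ (1 - X * S) = -N * (1 - X * S) := by
    rw [neg_mul, hN, map_sub, derivative_one, derivative_X_mul, derivative_X_mul, hS,
      derivative_rescale, derivative_map, map_add, map_mul, map_X, map_add, map_mul, rescale_X]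
    ring
  have honeρ : d⁄dX K⟦X⟧ (1 - X * C ρ) = -F * (1 - X * C ρ) := by
    rw [neg_mul, hF, map_sub, derivative_one, derivative_X_mul, derivative_C]
    ring
  refine eq_of_derivative_eq_mul (derivative_mul_of_logDeriv hE' honeS) ?_ ?_
  · rw [derivative_mul_of_logDeriv honeρ hS']
    linear_combination (1 - X * C ρ) * S * hFN
  · have hE0 : constantCoeff E = 1 := by
      rw [← coeff_zero_eq_constantCoeff_apply, hE, coeff_rescale, pow_zero, one_mul,
        coeff_zero_eq_constantCoeff_apply, constantCoeff_exp_subst (constantCoeff_neg_posLog ρ)]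
    have hS0 : constantCoeff S = 1 := by
      rw [← coeff_zero_eq_constantCoeff_apply, hS, coeff_rescale_X_map_C]
      simp [hσ]
    simp [hE0, hS0]

theorem exp_posLog_mul (hσ : constantCoeff σ = 1) (h : ρ.subst (X * σ) = σ) :
    (exp K⟦X⟧).subst (-posLog ρ) * (C X - map C (X * σ)) * X =
      (C X - X * C ρ) * map C (X * σ) := by
  apply rescale_injective (X_ne_zero (R := K))
  simp only [map_mul, map_sub, rescale_X, map_X, rescale_C]
  linear_combination C X * C X * X * rescale_exp_posLog_mul hσ h

end Factorization

section TwoVariables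

variable {A : Type*} [CommRing A]

/-- The divided difference `(ψ(y) - ψ(x)) / (y - x)`, where `x` is the outer and `y` the inner
variable. -/
noncomputable def divDiff (ψ : A⟦X⟧) : A⟦X⟧⟦X⟧ :=
  mk fun n => mk fun m => coeff (n + m + 1) ψ

theorem divDiff_mul_sub (ψ : A⟦X⟧) : divDiff ψ * (C X - X) = C ψ - map C ψ := by
  ext n m
  rw [mul_sub, map_sub, map_sub, map_sub, map_sub, coeff_mul_C, coeff_map, coeff_C, coeff_C]
  cases n <;> cases m <;>
    simp [divDiff, coeff_succ_mul_X, add_assoc, add_comm, add_left_comm]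

variable {K : Type*} [Field K]

/-- The double series `∑_{n, m, j} j · (1/n) [z^{n+j}] ρ^n · (1/m) [z^{m-j}] ρ^m · x^n y^m`, where
`x` is the outer and `y` the inner variable. -/
noncomputable def logKernel (ρ : K⟦X⟧) : K⟦X⟧⟦X⟧ :=
  mk fun n => mk fun m => ∑ p ∈ antidiagonal m,
    p.1 * ((n : K)⁻¹ * coeff (n + p.1) (ρ ^ n)) * ((m : K)⁻¹ * coeff p.2 (ρ ^ m))

theorem constantCoeff_neg_logKernel (ρ : K⟦X⟧) : constantCoeff (-logKernel ρ) = 0 := by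
  rw [map_neg, neg_eq_zero, ← coeff_zero_eq_constantCoeff_apply]
  ext m
  simp [logKernel]

variable [CharZero K] {ρ σ : K⟦X⟧}

theorem map_subst_posLog (hσ : constantCoeff σ ≠ 0) (h : ρ.subst (X * σ) = σ) :
    map (substXMul σ) (posLog ρ) = logKernel ρ := by
  ext n m
  rw [coeff_map, posLog, logKernel, coeff_mk, coeff_mk, coeff_mk, map_mul, substXMul_C,
    substXMul_apply, coeff_C_mul, coeff_subst_X_mul, Finset.mul_sum]
  refine Finset.sum_congr rfl fun p hp => ?_
  obtain rfl := mem_antidiagonal.1 hp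
  rcases Nat.eq_zero_or_pos p.1 with hp1 | hp1
  · simp [posPart, hp1]
  · have hcast : ((p.1 + p.2 : ℕ) : K) ≠ 0 := Nat.cast_ne_zero.2 (by lia)
    rw [posPart, coeff_mk, if_neg hp1.ne', ← mul_right_inj' hcast]
    linear_combination (n : K)⁻¹ * coeff (n + p.1) (ρ ^ n) * (lagrange_inversion hσ h p.1 p.2) -
      p.1 * (n : K)⁻¹ * coeff (n + p.1) (ρ ^ n) * coeff p.2 (ρ ^ (p.1 + p.2)) *
        mul_inv_cancel₀ hcast

theorem exp_logKernel_mul_divDiff (hσ : constantCoeff σ = 1) (h : ρ.subst (X * σ) = σ) :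
    (exp K⟦X⟧).subst (-logKernel ρ) * divDiff (X * σ) = map C σ * C σ := by
  have hσ0 : constantCoeff σ ≠ 0 := hσ ▸ one_ne_zero
  have hmap (f : K⟦X⟧) : map (substXMul σ) (map C f) = map C f := by
    rw [← RingHom.comp_apply, ← map_comp, RingHom.ext (substXMul_C σ) (f := (substXMul σ).comp C)]
  have hexp : map (substXMul σ) ((exp K⟦X⟧).subst (-posLog ρ)) =
      (exp K⟦X⟧).subst (-logKernel ρ) := by
    rw [map_exp_subst _ (by rw [map_X]) (constantCoeff_neg_posLog ρ), map_neg,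
      map_subst_posLog hσ0 h]
  have hfactor := congrArg (map (substXMul σ)) (exp_posLog_mul hσ h)
  simp only [map_mul (map (substXMul σ)), map_sub, map_C, map_X, hexp, hmap, substXMul_apply, h,
    subst_X (hasSubst_X_mul σ), ← divDiff_mul_sub] at hfactor
  have hX : map (C : K →+* K⟦X⟧) (X * σ) = X * map C σ := by rw [map_mul, map_X]
  have hCX : (C (X * σ) : K⟦X⟧⟦X⟧) = C X * C σ := map_mul _ _ _
  have hne : X * (C X - X : K⟦X⟧⟦X⟧) ≠ 0 := by
    refine mul_ne_zero X_ne_zero fun h0 => X_ne_zero (R := K) ?_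
    simpa using congrArg constantCoeff h0
  apply mul_right_cancel₀ hne
  rw [hX, hCX] at hfactor
  linear_combination hfactor

end TwoVariables

section Evaluation

variable {A : Type*} [CommRing A]

/-- The substitution `x = a s`, `y = b s` in a double series with outer variable `x` and inner
variable `y`. -/
noncomputable def lineEval (a b : A) : A⟦X⟧⟦X⟧ →+* A⟦X⟧ where
  toFun F := mk fun n => ∑ p ∈ antidiagonal n, a ^ p.1 * b ^ p.2 * coeff p.2 (coeff p.1 F)
  map_zero' := by
    ext n
    simp
  map_one' := by
    ext n
    rw [coeff_mk, coeff_one]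
    split_ifs with hn
    · simp [hn]
    · refine Finset.sum_eq_zero fun p hp => ?_
      rw [mem_antidiagonal] at hp
      rw [coeff_one]
      split_ifs with hp1
      · rw [coeff_one, if_neg (by lia), mul_zero]
      · rw [map_zero, mul_zero]
  map_add' F F' := by
    ext n
    simp [mul_add, Finset.sum_add_distrib]
  map_mul' F F' := by
    ext n
    simp only [coeff_mk, coeff_mul, map_sum, Finset.mul_sum, Finset.sum_mul, ← Finset.sum_product']
    rw [Finset.sum_sigma', Finset.sum_sigma']
    refine Finset.sum_nbij'
      (fun x => ⟨(x.2.1.1 + x.2.2.1, x.2.1.2 + x.2.2.2), (x.2.1.2, x.2.2.2), (x.2.1.1, x.2.2.1)⟩)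
      (fun x => ⟨(x.2.2.1 + x.2.1.1, x.2.2.2 + x.2.1.2), (x.2.2.1, x.2.1.1), (x.2.2.2, x.2.1.2)⟩)
      ?_ ?_ ?_ ?_ ?_ <;> rintro ⟨⟨p, q⟩, ⟨i, j⟩, k, l⟩ hx <;>
        simp only [Finset.mem_sigma, Finset.mem_product, mem_antidiagonal] at hx ⊢
    · lia
    · lia
    · simp only [hx]
    · simp only [hx]
    · simp only [← hx]
      ring

variable (a b : A)

theorem coeff_lineEval (F : A⟦X⟧⟦X⟧) (n : ℕ) : coeff n (lineEval a b F) =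
    ∑ p ∈ antidiagonal n, a ^ p.1 * b ^ p.2 * coeff p.2 (coeff p.1 F) := by
  simp only [lineEval, RingHom.coe_mk, MonoidHom.coe_mk, OneHom.coe_mk, coeff_mk]

theorem lineEval_C (f : A⟦X⟧) : lineEval a b (C f) = rescale b f := by
  ext n
  rw [coeff_lineEval, coeff_rescale, Finset.sum_eq_single (0, n)]
  · simp
  · rintro ⟨p, q⟩ hpq hne
    have hp : p ≠ 0 := by
      rintro rfl
      exact hne (by simpa using hpq)
    rw [coeff_C, if_neg hp, map_zero, mul_zero]
  · simp

theorem lineEval_map_C (f : A⟦X⟧) : lineEval a b (map C f) = rescale a f := by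
  ext n
  rw [coeff_lineEval, coeff_rescale, Finset.sum_eq_single (n, 0)]
  · simp
  · rintro ⟨p, q⟩ hpq hne
    have hq : q ≠ 0 := by
      rintro rfl
      exact hne (by simpa using hpq)
    rw [coeff_map, coeff_C, if_neg hq, mul_zero]
  · simp

theorem lineEval_X : lineEval a b X = C a * X := by
  simpa [rescale_X] using lineEval_map_C a b X

theorem X_dvd_lineEval_X : X ∣ lineEval a b X := by
  rw [lineEval_X]
  exact dvd_mul_left _ _

theorem lineEval_divDiff_mul_sub (ψ : A⟦X⟧) :
    lineEval a b (divDiff ψ) * (C (b - a) * X) = rescale b ψ - rescale a ψ := by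
  have h := congrArg (lineEval a b) (divDiff_mul_sub ψ)
  rwa [map_mul, map_sub, map_sub, lineEval_X, lineEval_C, lineEval_C, lineEval_map_C, rescale_X,
    ← sub_mul, ← map_sub] at h

theorem lineEval_divDiff_self (ψ : A⟦X⟧) :
    lineEval a a (divDiff ψ) = rescale a (d⁄dX A ψ) := by
  ext n
  rw [coeff_lineEval, coeff_rescale, coeff_derivative, Finset.sum_congr rfl
    (g := fun _ => a ^ n * coeff (n + 1) ψ)]
  · simp
    ring
  · intro p hp
    rw [← mem_antidiagonal.1 hp, divDiff, coeff_mk, coeff_mk, pow_add]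

theorem constantCoeff_lineEval_of_constantCoeff_eq_zero {F : A⟦X⟧⟦X⟧} (hF : constantCoeff F = 0) :
    constantCoeff (lineEval a b F) = 0 := by
  rw [← coeff_zero_eq_constantCoeff_apply, coeff_lineEval]
  simp [hF]

end Evaluation

section PowerSums

variable {L : Type*} [Field L] {ι : Type*} [Fintype ι] {e : ℕ} {r : L} {c : ι → L}

theorem nodal_eq_X_pow_sub_C (hι : Fintype.card ι = e) (he : e ≠ 0) (hinj : Function.Injective c)
    (hc : ∀ i, c i ^ e = r) :
    Lagrange.nodal Finset.univ c = Polynomial.X ^ e - Polynomial.C r := by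
  classical
  refine Polynomial.eq_of_degree_sub_lt_of_eval_finset_eq (Finset.univ.image c) ?_ ?_
  · have hdegree : (Lagrange.nodal Finset.univ c).degree = e := by
      rw [Lagrange.degree_nodal, Finset.card_univ, hι]
    rw [Finset.card_image_of_injective _ hinj, Finset.card_univ, hι, ← hdegree]
    refine Polynomial.degree_sub_lt_left ?_ Lagrange.nodal_ne_zero ?_
    · rw [hdegree, Polynomial.degree_X_pow_sub_C he.bot_lt]
    · rw [Lagrange.nodal_monic.leadingCoeff, Polynomial.leadingCoeff_X_pow_sub_C he.bot_lt]
  · intro x hx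
    obtain ⟨i, -, rfl⟩ := Finset.mem_image.1 hx
    rw [Lagrange.eval_nodal_at_node (Finset.mem_univ i)]
    simp [hc]

theorem prod_erase_sub_eq [DecidableEq ι] (hι : Fintype.card ι = e) (he : e ≠ 0)
    (hinj : Function.Injective c) (hc : ∀ i, c i ^ e = r) (i : ι) :
    ∏ j ∈ Finset.univ.erase i, (c i - c j) = e * c i ^ (e - 1) := by
  rw [← Lagrange.eval_nodal, ← Lagrange.eval_nodal_derivative_eval_node_eq (Finset.mem_univ i),
    nodal_eq_X_pow_sub_C hι he hinj hc]
  simp [Polynomial.derivative_X_pow]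

theorem sum_pow_mul (hι : Fintype.card ι = e) (hc : ∀ i, c i ^ e = r) (n : ℕ) :
    ∑ i, c i ^ (e * n) = e * r ^ n := by
  simp [pow_mul, hc, hι]

theorem sum_pow_eq_zero (hι : Fintype.card ι = e) (he : (e : L) ≠ 0)
    (hinj : Function.Injective c) (hc : ∀ i, c i ^ e = r) (hr : r ≠ 0) {n : ℕ} (hn : ¬ e ∣ n) :
    ∑ i, c i ^ n = 0 := by
  classical
  have he0 : e ≠ 0 := fun h0 => he (by rw [h0, Nat.cast_zero])
  have hc0 (i : ι) : c i ≠ 0 := by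
    intro hi
    exact hr (by rw [← hc i, hi, zero_pow he0])
  obtain ⟨k, hk⟩ := Nat.exists_eq_succ_of_ne_zero fun h => hn (Nat.dvd_of_mod_eq_zero h)
  have hke : k + 1 < e := by
    have := Nat.mod_lt n he0.bot_lt
    lia
  have hinterp := Lagrange.coeff_eq_sum (s := Finset.univ) hinj.injOn
    (P := Polynomial.X ^ k) (by
      rw [Polynomial.degree_X_pow, Finset.card_univ, hι]
      exact_mod_cast (Nat.lt_succ_self k).trans hke)
  rw [Polynomial.coeff_X_pow, Finset.card_univ, hι, if_neg (by lia)] at hinterp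
  have hpow (i : ι) : c i ^ n = r ^ (n / e) * c i ^ (k + 1) := by
    rw [← hc i, ← pow_mul, ← pow_add, ← Nat.succ_eq_add_one, ← hk, Nat.div_add_mod]
  have hterm (i : ι) : c i ^ n = r ^ (n / e) * (e * r) *
      ((Polynomial.X ^ k).eval (c i) / ∏ j ∈ Finset.univ.erase i, (c i - c j)) := by
    have hr' : r = c i ^ (e - 1) * c i := by rw [pow_sub_one_mul he0, hc]
    have hne := pow_ne_zero (e - 1) (hc0 i)
    rw [prod_erase_sub_eq hι he0 hinj hc, Polynomial.eval_X_pow, hpow, mul_assoc]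
    congr 1
    rw [hr']
    field_simp
    rw [pow_succ']
  rw [Finset.sum_congr rfl fun i _ => hterm i, ← Finset.mul_sum, ← hinterp, mul_zero]

end PowerSums

section Exponent

theorem sum_antidiagonal_mul_left {M : Type*} [AddCommMonoid M] {e : ℕ} (he : e ≠ 0) (n : ℕ)
    {f : ℕ × ℕ → M} (hf : ∀ p, ¬ (e ∣ p.1 ∧ e ∣ p.2) → f p = 0) :
    ∑ p ∈ antidiagonal (e * n), f p = ∑ p ∈ antidiagonal n, f (e * p.1, e * p.2) := by
  refine (Finset.sum_of_injOn (fun p : ℕ × ℕ => (e * p.1, e * p.2)) ?_ ?_ ?_ fun _ _ => rfl).symm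
  · intro p _ q _ hpq
    simpa [he, Prod.ext_iff] using hpq
  · intro p hp
    simp only [Finset.mem_coe, mem_antidiagonal] at hp ⊢
    rw [← hp, mul_add]
  · rintro ⟨p, q⟩ hpq hnot
    refine hf _ ?_
    rintro ⟨⟨a, rfl⟩, b, rfl⟩
    rw [mem_antidiagonal, ← mul_add] at hpq
    exact hnot ⟨(a, b), by simpa using Nat.eq_of_mul_eq_mul_left he.bot_lt hpq, rfl⟩

theorem sum_sum_lineEval {L : Type*} [Field L] {ι : Type*} [Fintype ι] {e : ℕ} {r : L}
    {c : ι → L} (hι : Fintype.card ι = e) (he : (e : L) ≠ 0) (hinj : Function.Injective c)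
    (hc : ∀ i, c i ^ e = r) (hr : r ≠ 0) (F : L⟦X⟧⟦X⟧) :
    ∑ i, ∑ j, lineEval (c i) (c j) F = (mk fun n => ∑ p ∈ antidiagonal n,
      e ^ 2 * r ^ n * coeff (e * p.2) (coeff (e * p.1) F)).subst (X ^ e : L⟦X⟧) := by
  have he0 : e ≠ 0 := fun h0 => he (by rw [h0, Nat.cast_zero])
  have hcoeff (n : ℕ) : coeff n (∑ i, ∑ j, lineEval (c i) (c j) F) = ∑ p ∈ antidiagonal n,
      (∑ i, c i ^ p.1) * (∑ j, c j ^ p.2) * coeff p.2 (coeff p.1 F) := by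
    simp only [map_sum, coeff_lineEval, Finset.sum_mul_sum]
    rw [Finset.sum_congr rfl fun i _ => Finset.sum_comm, Finset.sum_comm]
    simp only [Finset.sum_mul]
  have hvanish (p : ℕ × ℕ) (hp : ¬ (e ∣ p.1 ∧ e ∣ p.2)) :
      (∑ i, c i ^ p.1) * (∑ j, c j ^ p.2) * coeff p.2 (coeff p.1 F) = 0 := by
    rcases not_and_or.1 hp with hp | hp <;> simp [sum_pow_eq_zero hι he hinj hc hr hp]
  ext n
  rw [hcoeff, coeff_subst_X_pow he0]
  split_ifs with hn
  · obtain ⟨n, rfl⟩ := hn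
    rw [sum_antidiagonal_mul_left he0 n hvanish, Nat.mul_div_cancel_left n he0.bot_lt, coeff_mk,
      Algebra.algebraMap_self_apply]
    refine Finset.sum_congr rfl fun p hp => ?_
    rw [sum_pow_mul hι hc, sum_pow_mul hι hc, ← mem_antidiagonal.1 hp, pow_add]
    ring
  · refine Finset.sum_eq_zero fun p hp => hvanish p fun hdvd => hn ?_
    rw [← mem_antidiagonal.1 hp]
    exact dvd_add hdvd.1 hdvd.2

variable {K L : Type*} [Field K] [Field L]

theorem constantCoeff_neg_exponentSeries (e : ℕ) (R : K⟦X⟧) :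
    constantCoeff (-exponentSeries e R) = 0 := by
  rw [map_neg, neg_eq_zero, ← coeff_zero_eq_constantCoeff_apply]
  simp [exponentSeries, Finset.filter_singleton]

theorem map_exponentSeries (φ : K →+* L) (e : ℕ) (R : K⟦X⟧) :
    map φ (exponentSeries e R) = exponentSeries e (map φ R) := by
  ext n
  simp [exponentSeries, ← map_pow, coeff_map]

theorem map_G [CharZero K] [CharZero L] (φ : K →+* L) (e : ℕ) (R : K⟦X⟧) :
    map φ (G e R) = G e (map φ R) := by
  rw [G, G, map_exp_subst _ (by rw [map_X]) (constantCoeff_neg_exponentSeries e R), map_neg,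
    map_exponentSeries]

variable {e : ℕ} {r : L} {ρ : L⟦X⟧}

theorem sum_antidiagonal_eq_sum_Icc {M : Type*} [AddCommMonoid M] {f : ℕ → ℕ → M} {n : ℕ}
    (hf : f 0 n = 0) : ∑ p ∈ antidiagonal n, f p.1 p.2 = ∑ j ∈ Finset.Icc 1 n, f j (n - j) := by
  rw [Finset.Nat.sum_antidiagonal_eq_sum_range_succ f, Finset.sum_range_succ', tsub_zero, hf,
    add_zero, Finset.range_eq_Ico, Finset.sum_Ico_add' (fun j => f j (n - j)), zero_add]
  rfl

theorem coeff_pow_C_mul_pow (r : L) (ρ : L⟦X⟧) (e n k : ℕ) :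
    coeff k ((C r * ρ ^ e) ^ n) = r ^ n * coeff k (ρ ^ (e * n)) := by
  rw [mul_pow, ← map_pow, coeff_C_mul, pow_mul]

theorem mul_coeff_logKernel (he : (e : L) ≠ 0) (r : L) (ρ : L⟦X⟧) (n m : ℕ) :
    e ^ 2 * r ^ (n + m) * coeff (e * m) (coeff (e * n) (logKernel ρ)) =
      ∑ j ∈ Finset.Icc 1 (m * e), j * ((1 / n) * coeff (n * e + j) ((C r * ρ ^ e) ^ n)) *
        ((1 / m) * coeff (m * e - j) ((C r * ρ ^ e) ^ m)) := by
  rw [← sum_antidiagonal_eq_sum_Icc (f := fun j k => (j : L) *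
    ((1 / n) * coeff (n * e + j) ((C r * ρ ^ e) ^ n)) * ((1 / m) * coeff k ((C r * ρ ^ e) ^ m)))
    (by simp), logKernel, coeff_mk, coeff_mk, Finset.mul_sum, mul_comm m e]
  refine Finset.sum_congr rfl fun p _ => ?_
  rw [coeff_pow_C_mul_pow, coeff_pow_C_mul_pow, mul_comm n e, Nat.cast_mul, Nat.cast_mul]
  field_simp
  ring

theorem coeff_exponentSeries (he : (e : L) ≠ 0) (r : L) (ρ : L⟦X⟧) (n : ℕ) :
    coeff n (exponentSeries e (C r * ρ ^ e)) = ∑ p ∈ antidiagonal n,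
      e ^ 2 * r ^ n * coeff (e * p.2) (coeff (e * p.1) (logKernel ρ)) := by
  rw [exponentSeries, coeff_mk, Finset.sum_filter_of_ne, ← Finset.Nat.sum_antidiagonal_swap]
  · refine Finset.sum_congr rfl fun p hp => ?_
    rw [← mem_antidiagonal.1 hp, mul_coeff_logKernel he]
    rfl
  · intro p _ hne
    contrapose! hne
    rcases p.1.eq_zero_or_pos with hp | hp
    · simp [hp]
    · simp [Nat.le_zero.1 (hne hp)]

theorem exponentSeries_subst {ι : Type*} [Fintype ι] {c : ι → L} (hι : Fintype.card ι = e)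
    (he : (e : L) ≠ 0) (hinj : Function.Injective c) (hc : ∀ i, c i ^ e = r) (hr : r ≠ 0) :
    (exponentSeries e (C r * ρ ^ e)).subst (X ^ e : L⟦X⟧) =
      ∑ i, ∑ j, lineEval (c i) (c j) (logKernel ρ) := by
  rw [sum_sum_lineEval hι he hinj hc hr]
  congr 1
  ext n
  rw [coeff_exponentSeries he, coeff_mk]

theorem G_subst [CharZero L] {ι : Type*} [Fintype ι] {c : ι → L} (hι : Fintype.card ι = e)
    (he : e ≠ 0) (hinj : Function.Injective c) (hc : ∀ i, c i ^ e = r) (hr : r ≠ 0) :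
    (G e (C r * ρ ^ e)).subst (X ^ e : L⟦X⟧) =
      ∏ i, ∏ j, lineEval (c i) (c j) ((exp L⟦X⟧).subst (-logKernel ρ)) := by
  have hs : HasSubst (X ^ e : L⟦X⟧) := HasSubst.X_pow he
  have h0 (i j : ι) : constantCoeff (lineEval (c i) (c j) (-logKernel ρ)) = 0 :=
    constantCoeff_lineEval_of_constantCoeff_eq_zero _ _ (constantCoeff_neg_logKernel ρ)
  have hsum : (-exponentSeries e (C r * ρ ^ e)).subst (X ^ e : L⟦X⟧) =
      ∑ i, ∑ j, lineEval (c i) (c j) (-logKernel ρ) := by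
    rw [← coe_substAlgHom hs, map_neg, coe_substAlgHom,
      exponentSeries_subst hι (Nat.cast_ne_zero.2 he) hinj hc hr]
    simp only [map_neg, Finset.sum_neg_distrib]
  have hprod (i : ι) : (exp L).subst (∑ j, lineEval (c i) (c j) (-logKernel ρ)) =
      ∏ j, lineEval (c i) (c j) ((exp L⟦X⟧).subst (-logKernel ρ)) := by
    rw [exp_subst_sum (A := L) Finset.univ fun j _ => h0 i j]
    exact Finset.prod_congr rfl fun j _ =>
      (map_exp_subst (lineEval (c i) (c j)) (X_dvd_lineEval_X _ _)
        (constantCoeff_neg_logKernel ρ)).symm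
  simp only [G, subst_comp_subst_apply (hasSubst_neg_exponentSeries e _) hs, hsum, ← hprod]
  refine exp_subst_sum (A := L) Finset.univ fun i _ => ?_
  rw [map_sum]
  exact Finset.sum_eq_zero fun j _ => h0 i j

end Exponent

section HahnSeriesEvaluation

variable {Γ A : Type*} [AddCommMonoid Γ] [LinearOrder Γ] [IsOrderedCancelAddMonoid Γ] [CommRing A]
  {x : HahnSeries Γ A}

theorem heval_C_eq_C (x : HahnSeries Γ A) (a : A) : heval x (C a) = HahnSeries.C a := by
  rw [HahnSeries.C_eq_algebraMap]
  exact (heval x).commutes a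

theorem heval_C_mul_X (hx : 0 < x.orderTop) (a : A) : heval x (C a * X) = HahnSeries.C a * x := by
  rw [map_mul, heval_X x hx, heval_C_eq_C]

theorem zero_le_orderTop_heval (hx : 0 < x.orderTop) (f : A⟦X⟧) : 0 ≤ (heval x f).orderTop := by
  refine HahnSeries.le_orderTop_iff_forall.2 fun g hg => ?_
  rw [coeff_heval, finsum_eq_zero_of_forall_eq_zero]
  intro n
  rw [HahnSeries.SummableFamily.coeff_apply,
    HahnSeries.SummableFamily.powerSeriesFamily_of_orderTop_pos hx, HahnSeries.coeff_smul,
    HahnSeries.coeff_eq_zero_of_lt_orderTop, smul_zero]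
  exact hg.trans_le ((nsmul_nonneg hx.le n).trans HahnSeries.orderTop_nsmul_le_orderTop_pow)

theorem zero_lt_orderTop_heval (hx : 0 < x.orderTop) {f : A⟦X⟧} (hf : constantCoeff f = 0) :
    0 < (heval x f).orderTop := by
  obtain ⟨u, rfl⟩ := X_dvd_iff.2 hf
  rw [map_mul, heval_X x hx]
  exact (add_pos_of_pos_of_nonneg hx (zero_le_orderTop_heval hx u)).trans_le
    HahnSeries.orderTop_add_le_mul

variable [Archimedean Γ]

theorem eq_zero_of_forall_nsmul_le_orderTop {a : WithTop Γ} (ha : 0 < a)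
    (h : ∀ n : ℕ, n • a ≤ x.orderTop) : x = 0 := by
  cases a with
  | top => simpa using h 1
  | coe a =>
    ext g
    obtain ⟨n, hn⟩ := exists_lt_nsmul (WithTop.coe_pos.1 ha) g
    refine HahnSeries.coeff_eq_zero_of_lt_orderTop (lt_of_lt_of_le ?_ (h n))
    exact_mod_cast hn

theorem powerSeries_ringHom_ext {B : Type*} [CommRing B] {φ φ' : B⟦X⟧ →+* HahnSeries Γ A}
    (hC : ∀ b, φ (C b) = φ' (C b)) (hX : φ X = φ' X) (hpos : 0 < (φ X).orderTop)
    (hφ : ∀ f, 0 ≤ (φ f).orderTop) (hφ' : ∀ f, 0 ≤ (φ' f).orderTop) : φ = φ' := by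
  have hpoly (p : Polynomial B) : φ p = φ' p :=
    RingHom.congr_fun (Polynomial.ringHom_ext
      (f := φ.comp Polynomial.coeToPowerSeries.ringHom)
      (g := φ'.comp Polynomial.coeToPowerSeries.ringHom) (by simpa using hC) (by simpa using hX)) p
  ext1 f
  refine sub_eq_zero.1 (eq_zero_of_forall_nsmul_le_orderTop hpos fun N => ?_)
  have hsub : φ f - φ' f = φ X ^ N *
      (φ (mk fun i => coeff (i + N) f) - φ' (mk fun i => coeff (i + N) f)) := by
    conv_lhs => rw [eq_X_pow_mul_shift_add_trunc N f]
    simp only [map_add, map_mul, map_pow, hpoly, hX]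
    ring
  rw [hsub]
  refine le_trans ?_ HahnSeries.orderTop_add_le_mul
  exact HahnSeries.orderTop_nsmul_le_orderTop_pow.trans (le_add_of_nonneg_right
    ((le_min (hφ _) (hφ' _)).trans HahnSeries.min_orderTop_le_orderTop_sub))

theorem heval_heval (hx : 0 < x.orderTop) {g : A⟦X⟧} (hg : constantCoeff g = 0) (f : A⟦X⟧) :
    heval (heval x g) f = heval x (f.subst g) := by
  have hs : HasSubst g := HasSubst.of_constantCoeff_zero' hg
  have hy := zero_lt_orderTop_heval hx hg
  rw [← coe_substAlgHom hs]
  refine RingHom.congr_fun (powerSeries_ringHom_ext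
    (φ := RingHomClass.toRingHom (heval (heval x g)))
    (φ' := RingHomClass.toRingHom ((heval x).comp (substAlgHom hs))) ?_ ?_ ?_ ?_ ?_) f
  · exact fun a => ((heval _).commutes a).trans (((heval x).comp (substAlgHom hs)).commutes a).symm
  · exact (heval_X _ hy).trans (congrArg (heval x) (substAlgHom_X hs).symm)
  · exact (heval_X _ hy).symm ▸ hy
  · exact zero_le_orderTop_heval hy
  · exact fun f => zero_le_orderTop_heval hx _

theorem heval_heval_rescale (hx : 0 < x.orderTop) (a : A) (σ f : A⟦X⟧) :
    heval (heval x (rescale a (X * σ))) f = heval x (rescale a (f.subst (X * σ))) := by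
  rw [heval_heval hx (by simp), rescale_eq_subst, rescale_eq_subst,
    subst_comp_subst_apply (hasSubst_X_mul σ) (HasSubst.smul_X' a)]

end HahnSeriesEvaluation

section LaurentEmbedding

variable {Γ A : Type*} [CommRing Γ] [LinearOrder Γ] [IsStrictOrderedRing Γ] [Archimedean Γ]
  [CommRing A] [Nontrivial A]

theorem ofPowerSeries_eq_heval_single (f : A⟦X⟧) :
    HahnSeries.ofPowerSeries Γ A f = heval (HahnSeries.single 1 1) f := by
  have h1 : 0 < (HahnSeries.single (1 : Γ) (1 : A)).orderTop := by
    rw [HahnSeries.orderTop_single one_ne_zero]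
    exact_mod_cast one_pos
  refine RingHom.congr_fun (powerSeries_ringHom_ext
    (φ' := RingHomClass.toRingHom (heval (HahnSeries.single (1 : Γ) (1 : A)))) ?_ ?_ ?_ ?_ ?_) f
  · exact fun a => (HahnSeries.ofPowerSeries_C a).trans (heval_C_eq_C _ a).symm
  · exact HahnSeries.ofPowerSeries_X.trans (heval_X _ h1).symm
  · rwa [HahnSeries.ofPowerSeries_X]
  · intro f
    refine HahnSeries.le_orderTop_iff_forall.2 fun g hg => ?_
    rw [HahnSeries.ofPowerSeries_apply]
    refine HahnSeries.embDomain_of_notMem_range ?_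
    rintro ⟨n, rfl⟩
    exact (WithTop.coe_lt_coe.1 hg).not_ge (Nat.cast_nonneg n)
  · exact zero_le_orderTop_heval h1

theorem ofPowerSeries_eq_heval {x : HahnSeries Γ A} (hx : 0 < x.orderTop) {e : ℕ} (he : e ≠ 0)
    (hxe : x ^ e = HahnSeries.single 1 1) (f : A⟦X⟧) :
    HahnSeries.ofPowerSeries Γ A f = heval x (f.subst (X ^ e : A⟦X⟧)) := by
  rw [← heval_heval hx (by simp [he]), map_pow, heval_X x hx, hxe, ofPowerSeries_eq_heval_single]

end LaurentEmbedding

section RootsOfConstants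

variable {Γ L : Type*} [AddCommMonoid Γ] [LinearOrder Γ] [IsOrderedCancelAddMonoid Γ] [Field L]
  {e : ℕ} {r : L} {v : HahnSeries Γ L}

theorem coeff_zero_pow_of_order_eq_zero (hv : v.order = 0) (n : ℕ) :
    (v ^ n).coeff 0 = v.coeff 0 ^ n := by
  have hmul : (v ^ n).leadingCoeff = v.leadingCoeff ^ n := by
    induction n with
    | zero => simp
    | succ n ih => rw [pow_succ, HahnSeries.leadingCoeff_mul, ih, pow_succ]
  rwa [HahnSeries.leadingCoeff_eq, HahnSeries.leadingCoeff_eq, HahnSeries.order_pow, hv,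
    nsmul_zero] at hmul

theorem eq_C_coeff_zero_of_pow_eq_C (he : (e : L) ≠ 0) (hr : r ≠ 0)
    (hv : v ^ e = HahnSeries.C r) : v.coeff 0 ^ e = r ∧ v = HahnSeries.C (v.coeff 0) := by
  have he0 : e ≠ 0 := fun h0 => he (by rw [h0, Nat.cast_zero])
  have hv0 : v ≠ 0 := by
    rintro rfl
    rw [zero_pow he0] at hv
    exact HahnSeries.C_ne_zero hr hv.symm
  have hord : v.order = 0 := by
    have h := congrArg HahnSeries.order hv
    rw [HahnSeries.order_pow, HahnSeries.order_C] at h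
    exact (nsmul_eq_zero_iff.1 h).resolve_right he0
  have hc : v.coeff 0 ≠ 0 := by
    rw [← hord]
    exact HahnSeries.coeff_order_eq_zero.not.2 hv0
  have hce : v.coeff 0 ^ e = r := by
    rw [← coeff_zero_pow_of_order_eq_zero hord, hv, HahnSeries.C_apply,
      HahnSeries.coeff_single_same]
  refine ⟨hce, ?_⟩
  set c := v.coeff 0
  have hgeom : (∑ i ∈ Finset.range e, v ^ i * HahnSeries.C c ^ (e - 1 - i)) *
      (v - HahnSeries.C c) = 0 := by
    rw [(Commute.all _ _).geom_sum₂_mul, hv, ← map_pow, hce, sub_self]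
  refine sub_eq_zero.1 ((mul_eq_zero.1 hgeom).resolve_left fun hsum => ?_)
  have hcoeff (i : ℕ) (hi : i ∈ Finset.range e) :
      (v ^ i * HahnSeries.C c ^ (e - 1 - i)).coeff 0 = c ^ (e - 1) := by
    rw [← map_pow, HahnSeries.C_apply, HahnSeries.coeff_mul_single_zero,
      coeff_zero_pow_of_order_eq_zero hord, ← pow_add, add_tsub_cancel_of_le]
    have := Finset.mem_range.1 hi
    lia
  have h0 := congrArg (fun w => HahnSeries.coeff w 0) hsum
  rw [HahnSeries.coeff_sum, Finset.sum_congr rfl hcoeff] at h0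
  simp [he, hc] at h0

end RootsOfConstants

section Branches

variable {L : Type*} [Field L] {e : ℕ}

/-- The series `q ^ (1 / e)`. -/
noncomputable def root (L : Type*) [Field L] (e : ℕ) : HahnSeries ℚ L :=
  HahnSeries.single (1 / (e : ℚ)) 1

theorem root_pow (he : e ≠ 0) : root L e ^ e = HahnSeries.single 1 1 := by
  rw [root, HahnSeries.single_pow, one_pow, nsmul_eq_mul,
    mul_one_div_cancel (Nat.cast_ne_zero.2 he)]

theorem zero_lt_orderTop_root (he : e ≠ 0) : 0 < (root L e).orderTop := by
  rw [root, HahnSeries.orderTop_single one_ne_zero]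
  have : (0 : ℚ) < 1 / (e : ℚ) := by positivity
  exact_mod_cast this

theorem root_ne_zero : root L e ≠ 0 :=
  HahnSeries.single_ne_zero one_ne_zero

theorem coeff_heval_root (he : e ≠ 0) (f : L⟦X⟧) (g : ℚ) :
    (heval (root L e) f).coeff g = ∑ᶠ n : ℕ, if g = n / e then coeff n f else 0 := by
  rw [coeff_heval]
  refine finsum_congr fun n => ?_
  rw [HahnSeries.SummableFamily.coeff_apply,
    HahnSeries.SummableFamily.powerSeriesFamily_of_orderTop_pos (zero_lt_orderTop_root he), root,
    HahnSeries.single_pow, HahnSeries.coeff_smul, HahnSeries.coeff_single, nsmul_eq_mul,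
    mul_one_div]
  split_ifs <;> simp

theorem heval_root_injective (he : e ≠ 0) : Function.Injective (heval (root L e)) := by
  have hcoeff (f : L⟦X⟧) (m : ℕ) : (heval (root L e) f).coeff (m / e) = coeff m f := by
    rw [coeff_heval_root he, finsum_eq_single _ m, if_pos rfl]
    intro n hn
    rw [if_neg]
    rw [div_left_inj' (Nat.cast_ne_zero.2 he), Nat.cast_inj]
    exact hn.symm
  intro f g hfg
  ext m
  rw [← hcoeff, ← hcoeff, hfg]

/-- The evaluation `f ↦ f(c q^{1/e})`. The solutions of `H ^ e = q R(H)` are the values of one power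
series at the `e`-th roots `c` of `R(0)`. -/
noncomputable def rootEval (e : ℕ) (c : L) : L⟦X⟧ →+* HahnSeries ℚ L :=
  (heval (root L e) : L⟦X⟧ →+* HahnSeries ℚ L).comp (rescale c)

theorem rootEval_apply (e : ℕ) (c : L) (f : L⟦X⟧) :
    rootEval e c f = heval (root L e) (rescale c f) :=
  rfl

theorem rootEval_C (e : ℕ) (c a : L) : rootEval e c (C a) = HahnSeries.C a := by
  rw [rootEval_apply, rescale_C, heval_C_eq_C]

theorem rootEval_X (he : e ≠ 0) (c : L) : rootEval e c X = HahnSeries.C c * root L e := by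
  rw [rootEval_apply, rescale_X, heval_C_mul_X (zero_lt_orderTop_root he)]

theorem rootEval_X_pow (he : e ≠ 0) (c : L) :
    rootEval e c X ^ e = HahnSeries.single 1 1 * HahnSeries.C (c ^ e) := by
  rw [rootEval_X he, mul_pow, root_pow he, map_pow, mul_comm]

theorem rootEval_ne_zero (he : e ≠ 0) (c : L) {f : L⟦X⟧} (hf : constantCoeff f ≠ 0) :
    rootEval e c f ≠ 0 := by
  rw [rootEval_apply]
  refine (map_ne_zero_iff _ (heval_root_injective he)).2 fun h => hf ?_
  simpa [coeff_rescale] using congrArg (coeff 0) h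

theorem zero_lt_orderTop_rootEval (he : e ≠ 0) (c : L) {f : L⟦X⟧} (hf : constantCoeff f = 0) :
    0 < (rootEval e c f).orderTop :=
  zero_lt_orderTop_heval (zero_lt_orderTop_root he) (by
    rw [← coeff_zero_eq_constantCoeff_apply, coeff_rescale, coeff_zero_eq_constantCoeff_apply, hf,
      mul_zero])

theorem isPuiseux_rootEval (he : e ≠ 0) (c : L) (f : L⟦X⟧) : IsPuiseux (rootEval e c f) := by
  refine ⟨e, Nat.pos_of_ne_zero he, fun a ha => ?_⟩
  by_contra! h
  refine ha ?_
  rw [rootEval_apply, coeff_heval_root he]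
  exact finsum_eq_zero_of_forall_eq_zero fun n => if_neg (by simpa using h n)

theorem rootEval_injective (he : e ≠ 0) {f : L⟦X⟧} (hf : coeff 1 f ≠ 0) :
    Function.Injective fun c : L => rootEval e c f := by
  intro a b hab
  have h1 := congrArg (coeff 1) (heval_root_injective he hab)
  rw [coeff_rescale, coeff_rescale, pow_one, pow_one] at h1
  exact mul_right_cancel₀ hf h1

theorem heval_rootEval (he : e ≠ 0) (c : L) (σ f : L⟦X⟧) :
    heval (rootEval e c (X * σ)) f = rootEval e c (f.subst (X * σ)) :=
  heval_heval_rescale (zero_lt_orderTop_root he) c σ f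

end Branches

section Solutions

variable {L : Type*} [Field L] {e : ℕ} {r : L} {ρ σ : L⟦X⟧}

theorem exists_eq_C_mul_pow_and_subst_eq [CharZero L] {R : L⟦X⟧} (he : e ≠ 0)
    (hR : constantCoeff R ≠ 0) :
    ∃ ρ σ : L⟦X⟧, R = C (constantCoeff R) * ρ ^ e ∧ constantCoeff ρ = 1 ∧ constantCoeff σ = 1 ∧
      ρ.subst (X * σ) = σ ∧ (X * σ).subst (X * ρ⁻¹) = X := by
  obtain ⟨ρ, hρe, hρ⟩ := exists_pow_eq_of_constantCoeff_eq_one he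
    (f := C (constantCoeff R)⁻¹ * R) (by rw [map_mul, constantCoeff_C, inv_mul_cancel₀ hR])
  obtain ⟨σ, h, h'⟩ := exists_subst_X_mul_eq (hρ.symm ▸ one_ne_zero : constantCoeff ρ ≠ 0)
  refine ⟨ρ, σ, ?_, hρ, (constantCoeff_eq_of_subst_eq h).symm.trans hρ, h, h'⟩
  rw [hρe, ← mul_assoc, ← map_mul, mul_inv_cancel₀ hR, map_one, one_mul]

theorem heval_rootEval_C_mul_pow (he : e ≠ 0) (h : ρ.subst (X * σ) = σ) (c : L) :
    heval (rootEval e c (X * σ)) (C r * ρ ^ e) = HahnSeries.C r * rootEval e c σ ^ e := by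
  rw [heval_rootEval he, ← substXMul_apply, map_mul, map_pow, substXMul_C, substXMul_apply, h,
    map_mul, map_pow, rootEval_C]

theorem rootEval_pow_eq (he : e ≠ 0) (h : ρ.subst (X * σ) = σ) {c : L} (hc : c ^ e = r) :
    rootEval e c (X * σ) ^ e =
      HahnSeries.single 1 1 * heval (rootEval e c (X * σ)) (C r * ρ ^ e) := by
  rw [heval_rootEval_C_mul_pow he h, map_mul, mul_pow, rootEval_X_pow he, hc, mul_assoc]

theorem exists_eq_rootEval_of_pow_eq (he : (e : L) ≠ 0) (hr : r ≠ 0) (hρ : constantCoeff ρ ≠ 0)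
    (h' : (X * σ).subst (X * ρ⁻¹) = X) {H : HahnSeries ℚ L} (hH : 0 < H.orderTop)
    (heq : H ^ e = HahnSeries.single 1 1 * heval H (C r * ρ ^ e)) :
    ∃ c, c ^ e = r ∧ H = rootEval e c (X * σ) := by
  have he0 : e ≠ 0 := fun h0 => he (by rw [h0, Nat.cast_zero])
  have hs := zero_lt_orderTop_root (L := L) he0
  have hρH : heval H ρ * heval H ρ⁻¹ = 1 := by
    rw [← map_mul, PowerSeries.mul_inv_cancel ρ hρ, map_one]
  have hpow : (heval H (X * ρ⁻¹) / root L e) ^ e = HahnSeries.C r := by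
    have hρe : heval H ρ ^ e * heval H ρ⁻¹ ^ e = 1 := by rw [← mul_pow, hρH, one_pow]
    rw [div_pow, div_eq_iff (pow_ne_zero e root_ne_zero), root_pow he0, map_mul, heval_X H hH,
      mul_pow, heq, map_mul, map_pow, heval_C_eq_C]
    linear_combination HahnSeries.single (1 : ℚ) (1 : L) * HahnSeries.C r * hρe
  obtain ⟨hc, hv⟩ := eq_C_coeff_zero_of_pow_eq_C he hr hpow
  generalize (heval H (X * ρ⁻¹) / root L e).coeff 0 = c at hc hv
  refine ⟨c, hc, ?_⟩
  have hinv : heval (heval H (X * ρ⁻¹)) (X * σ) = H := by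
    rw [heval_heval hH (by simp), h', heval_X H hH]
  rw [rootEval_apply, rescale_eq_subst, ← heval_heval hs (by simp), smul_eq_C_mul,
    heval_C_mul_X hs, ← hv, div_mul_cancel₀ _ root_ne_zero, hinv]

variable {K : Type*} [Field K] [Algebra K L] {R : K⟦X⟧}

theorem mem_solutions_iff (he : (e : L) ≠ 0) (hr : r ≠ 0)
    (hR : map (algebraMap K L) R = C r * ρ ^ e) (hρ : constantCoeff ρ ≠ 0)
    (h : ρ.subst (X * σ) = σ) (h' : (X * σ).subst (X * ρ⁻¹) = X) {H : HahnSeries ℚ L} :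
    H ∈ solutions L e R ↔ ∃ c, c ^ e = r ∧ rootEval e c (X * σ) = H := by
  have he0 : e ≠ 0 := fun h0 => he (by rw [h0, Nat.cast_zero])
  rw [solutions, Set.mem_ofPred_eq, evalAt, hR]
  constructor
  · rintro ⟨-, hH, heq⟩
    obtain ⟨c, hc, rfl⟩ := exists_eq_rootEval_of_pow_eq he hr hρ h' hH heq
    exact ⟨c, hc, rfl⟩
  · rintro ⟨c, hc, rfl⟩
    exact ⟨isPuiseux_rootEval he0 c _, zero_lt_orderTop_rootEval he0 c (by simp),
      rootEval_pow_eq he0 h hc⟩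

theorem ncard_solutions [IsAlgClosed L] (he : (e : L) ≠ 0) (hr : r ≠ 0)
    (hR : map (algebraMap K L) R = C r * ρ ^ e) (hρ : constantCoeff ρ ≠ 0)
    (h : ρ.subst (X * σ) = σ) (h' : (X * σ).subst (X * ρ⁻¹) = X) :
    (solutions L e R).ncard = e := by
  classical
  have he0 : e ≠ 0 := fun h0 => he (by rw [h0, Nat.cast_zero])
  have hσ : coeff 1 (X * σ) ≠ 0 := by
    rwa [coeff_one_X_mul, ← constantCoeff_eq_of_subst_eq h]
  have himage : solutions L e R = (fun c : L => rootEval e c (X * σ)) ''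
      ((Polynomial.nthRoots e r).toFinset : Set L) := by
    ext H
    simp only [mem_solutions_iff he hr hR hρ h h', Set.mem_image, Finset.mem_coe,
      Multiset.mem_toFinset, Polynomial.mem_nthRoots (Nat.pos_of_ne_zero he0)]
  rw [himage, Set.ncard_image_of_injective _ (rootEval_injective he0 hσ), Set.ncard_coe_finset,
    Polynomial.nthRoots, Multiset.toFinset_card_of_nodup (Polynomial.nodup_roots
      (Polynomial.separable_X_pow_sub_C r he hr)),
    Polynomial.splits_iff_card_roots.1 (IsAlgClosed.splits _), Polynomial.natDegree_X_pow_sub_C]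

end Solutions

section FinalProduct

variable {F ι : Type*} [Field F] [Fintype ι] [DecidableEq ι] {e : ℕ} {w : F} {u S T H : ι → F}
  {E : ι → ι → F}

theorem prod_filter_ne_eq_prod_prod_erase {M : Type*} [CommMonoid M] (f : ι → ι → M) :
    ∏ p ∈ (Finset.univ : Finset (ι × ι)).filter (fun p => p.1 ≠ p.2), f p.1 p.2 =
      ∏ i, ∏ j ∈ Finset.univ.erase i, f j i := by
  rw [Finset.prod_filter, Fintype.prod_prod_type_right]
  refine Finset.prod_congr rfl fun i _ => ?_
  rw [← Finset.prod_filter, ← Finset.filter_ne']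

theorem prod_mul_eq_of_mul_sub_eq (hι : Fintype.card ι = e) (he : e ≠ 0)
    (hu : Function.Injective u) (huw : ∀ i, u i ^ e = w) (hinj : Function.Injective H)
    (hE : ∀ i j, E i j * (H j - H i) = S i * S j * (u j - u i))
    (hEdiag : ∀ i, E i i * T i = S i * S i) (i : ι) :
    (∏ j, E j i) * T i =
      (∏ j, S j) * S i ^ e * (e * u i ^ (e - 1)) * ∏ j ∈ Finset.univ.erase i, 1 / (H i - H j) := by
  have hoff : ∏ j ∈ Finset.univ.erase i, E j i =
      ∏ j ∈ Finset.univ.erase i, S j * S i * (u i - u j) * (1 / (H i - H j)) := by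
    refine Finset.prod_congr rfl fun j hj => ?_
    rw [mul_one_div, eq_div_iff (sub_ne_zero.2 (hinj.ne (Finset.ne_of_mem_erase hj).symm)), hE]
  have hcard : (Finset.univ.erase i).card = e - 1 := by
    rw [Finset.card_erase_of_mem (Finset.mem_univ i), Finset.card_univ, hι]
  rw [← Finset.mul_prod_erase _ _ (Finset.mem_univ i), mul_right_comm, hEdiag, hoff,
    ← Finset.mul_prod_erase _ S (Finset.mem_univ i), ← mul_pow_sub_one he (S i)]
  simp only [Finset.prod_mul_distrib, Finset.prod_const, hcard, prod_erase_sub_eq hι he hu huw]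
  ring

theorem prod_prod_eq_of_mul_sub_eq (hι : Fintype.card ι = e) (he : e ≠ 0)
    (hu : Function.Injective u) (huw : ∀ i, u i ^ e = w) (hw : w ≠ 0) (hT : ∀ i, T i ≠ 0)
    (hinj : Function.Injective H) (hH : ∀ i, H i = u i * S i)
    (hE : ∀ i j, E i j * (H j - H i) = S i * S j * (u j - u i))
    (hEdiag : ∀ i, E i i * T i = S i * S i) :
    ∏ i, ∏ j, E i j = (∏ i, S i ^ e) * (∏ i, H i ^ e) *
      (∏ p ∈ (Finset.univ : Finset (ι × ι)).filter (fun p => p.1 ≠ p.2), 1 / (H p.2 - H p.1)) *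
      ∏ i, (e : F) / (u i * T i) := by
  have hu0 (i : ι) : u i ≠ 0 := fun h => hw (by rw [← huw i, h, zero_pow he])
  have hSS : ∏ i, S i ^ e = ∏ _i : ι, ∏ j, S j := by
    rw [Finset.prod_const, Finset.card_univ, hι, Finset.prod_pow]
  rw [prod_filter_ne_eq_prod_prod_erase fun i j => 1 / (H j - H i), Finset.prod_comm, hSS]
  simp only [← Finset.prod_mul_distrib]
  refine Finset.prod_congr rfl fun i _ => mul_right_cancel₀ (hT i) ?_
  rw [prod_mul_eq_of_mul_sub_eq hι he hu huw hinj hE hEdiag, hH, mul_pow,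
    ← mul_pow_sub_one he (u i)]
  have := hu0 i
  have := hT i
  field_simp

end FinalProduct

section Evaluation

variable {L : Type*} [Field L] {e : ℕ} {r : L} {ρ σ : L⟦X⟧}

theorem rootEval_derivative_mul_one_sub (he : e ≠ 0) (h : ρ.subst (X * σ) = σ) (c : L) :
    rootEval e c (d⁄dX L (X * σ)) *
      (1 - rootEval e c X * heval (rootEval e c (X * σ)) (d⁄dX L ρ)) = rootEval e c σ := by
  have hchain := derivative_subst (f := ρ) (hasSubst_X_mul σ)
  rw [h] at hchain
  rw [heval_rootEval he, ← map_mul, ← map_one (rootEval e c), ← map_sub, ← map_mul]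
  refine congrArg (rootEval e c) ?_
  have hderiv := derivative_X_mul σ
  linear_combination hderiv + X * hchain

theorem div_sub_logDeriv_eq (he : e ≠ 0) (hr : r ≠ 0) (hσ : constantCoeff σ ≠ 0)
    (h : ρ.subst (X * σ) = σ) {c : L} (hc : c ≠ 0) :
    (e : HahnSeries ℚ L) / rootEval e c (X * σ) -
        heval (rootEval e c (X * σ)) (d⁄dX L (C r * ρ ^ e)) /
          heval (rootEval e c (X * σ)) (C r * ρ ^ e) =
      e / (rootEval e c X * rootEval e c (d⁄dX L (X * σ))) := by
  have hderiv : d⁄dX L (C r * ρ ^ e) = C r * ((e : L⟦X⟧) * ρ ^ (e - 1) * d⁄dX L ρ) := by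
    rw [derivative_mul, derivative_C, derivative_pow]
    ring
  have hρσ : heval (rootEval e c (X * σ)) ρ = rootEval e c σ := by rw [heval_rootEval he, h]
  have hX : rootEval e c X ≠ 0 := by
    rw [rootEval_X he]
    exact mul_ne_zero (HahnSeries.C_ne_zero hc) root_ne_zero
  have hS : rootEval e c σ ≠ 0 := rootEval_ne_zero he c hσ
  have hT : rootEval e c (d⁄dX L (X * σ)) ≠ 0 :=
    rootEval_ne_zero he c (by rwa [constantCoeff_derivative_X_mul])
  have hTS := rootEval_derivative_mul_one_sub he h c
  have hC : (HahnSeries.C r : HahnSeries ℚ L) ≠ 0 := HahnSeries.C_ne_zero hr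
  rw [heval_rootEval_C_mul_pow he h, hderiv]
  simp only [map_mul (heval _), map_pow, heval_C_eq_C, map_natCast, hρσ]
  generalize heval (rootEval e c (X * σ)) (d⁄dX L ρ) = D at hTS ⊢
  rw [map_mul (rootEval e c), ← mul_pow_sub_one he (rootEval e c σ)]
  have hpow := pow_ne_zero (e - 1) hS
  field_simp
  linear_combination e * hTS

theorem lineEval_exp_logKernel_mul_sub [CharZero L] (hσ : constantCoeff σ = 1)
    (h : ρ.subst (X * σ) = σ) (a b : L) :
    lineEval a b ((exp L⟦X⟧).subst (-logKernel ρ)) *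
        (rescale b (X * σ) - rescale a (X * σ)) =
      rescale a σ * rescale b σ * (C (b - a) * X) := by
  rw [← lineEval_divDiff_mul_sub, ← mul_assoc, ← map_mul, exp_logKernel_mul_divDiff hσ h, map_mul,
    lineEval_map_C, lineEval_C]

theorem lineEval_exp_logKernel_self [CharZero L] (hσ : constantCoeff σ = 1)
    (h : ρ.subst (X * σ) = σ) (a : L) :
    lineEval a a ((exp L⟦X⟧).subst (-logKernel ρ)) * rescale a (d⁄dX L (X * σ)) =
      rescale a σ * rescale a σ := by
  rw [← lineEval_divDiff_self, ← map_mul, exp_logKernel_mul_divDiff hσ h, map_mul,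
    lineEval_map_C, lineEval_C]

theorem ofPowerSeries_G_eq [CharZero L] {ι : Type*} [Fintype ι] [DecidableEq ι] {c : ι → L}
    (hι : Fintype.card ι = e) (he : e ≠ 0) (hr : r ≠ 0) (hσ : constantCoeff σ = 1)
    (h : ρ.subst (X * σ) = σ) (hinj : Function.Injective c) (hc : ∀ i, c i ^ e = r)
    {H : ι → HahnSeries ℚ L} (hH : ∀ i, rootEval e (c i) (X * σ) = H i) :
    HahnSeries.ofPowerSeries ℚ L (G e (C r * ρ ^ e)) =
      (∏ i, heval (H i) (C r * ρ ^ e) / HahnSeries.C r) * (∏ i, H i ^ e) *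
        (∏ p ∈ (Finset.univ : Finset (ι × ι)).filter (fun p => p.1 ≠ p.2),
          1 / (H p.2 - H p.1)) *
        ∏ i, ((e : HahnSeries ℚ L) / H i -
          heval (H i) (d⁄dX L (C r * ρ ^ e)) / heval (H i) (C r * ρ ^ e)) := by
  obtain rfl : (fun i => rootEval e (c i) (X * σ)) = H := funext hH
  have hσ0 : constantCoeff σ ≠ 0 := hσ ▸ one_ne_zero
  have hc0 (i : ι) : c i ≠ 0 := fun h0 => hr (by rw [← hc i, h0, zero_pow he])
  have hC : (HahnSeries.C r : HahnSeries ℚ L) ≠ 0 := HahnSeries.C_ne_zero hr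
  have hcoeff : coeff 1 (X * σ) ≠ 0 := by rwa [coeff_one_X_mul]
  rw [ofPowerSeries_eq_heval (zero_lt_orderTop_root he) he (root_pow he),
    G_subst hι he hinj hc hr]
  simp only [map_prod, fun i => div_sub_logDeriv_eq he hr hσ0 h (hc0 i)]
  simp only [heval_rootEval_C_mul_pow he h, mul_div_cancel_left₀ _ hC]
  refine prod_prod_eq_of_mul_sub_eq hι he (u := fun i => rootEval e (c i) X)
    (w := HahnSeries.single 1 1 * HahnSeries.C r) ?_ ?_ ?_ ?_ ?_ ?_ ?_ ?_
  · exact (rootEval_injective he (f := X) (by simp)).comp hinj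
  · exact fun i => by rw [rootEval_X_pow he, hc]
  · exact mul_ne_zero (HahnSeries.single_ne_zero one_ne_zero) hC
  · exact fun i => rootEval_ne_zero he _ (by rwa [constantCoeff_derivative_X_mul])
  · exact (rootEval_injective he hcoeff).comp hinj
  · exact fun i => map_mul _ _ _
  · intro i j
    have hsub := congrArg (heval (root L e)) (lineEval_exp_logKernel_mul_sub hσ h (c i) (c j))
    rw [map_sub C, sub_mul, ← rescale_X, ← rescale_X] at hsub
    simpa only [map_mul, map_sub, rootEval_apply] using hsub
  · intro i
    rw [rootEval_apply, rootEval_apply, ← map_mul, ← map_mul, lineEval_exp_logKernel_self hσ h]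

end Evaluation

end NewtonPuiseux

theorem mainTheorem1 {K L : Type*} [Field K] [CharZero K] [Field L] [Algebra K L]
    (e : ℕ) (he : 0 < e) (R : PowerSeries K) (hR : PowerSeries.constantCoeff R ≠ 0) :
    (IsAlgClosed L → (NewtonPuiseux.solutions L e R).ncard = e) ∧
    ∀ H : Fin e → HahnSeries ℚ L, Function.Injective H →
      (∀ i, H i ∈ NewtonPuiseux.solutions L e R) →
      NewtonPuiseux.toHahn L (NewtonPuiseux.G e R) =
        (∏ i, NewtonPuiseux.evalAt R (H i) /
            HahnSeries.C (algebraMap K L (PowerSeries.constantCoeff R))) *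
          (∏ i, H i ^ e) *
          (∏ p ∈ (Finset.univ : Finset (Fin e × Fin e)).filter (fun p => p.1 ≠ p.2),
            1 / (H p.2 - H p.1)) *
          ∏ i, ((e : HahnSeries ℚ L) / H i -
            NewtonPuiseux.evalAt (PowerSeries.derivative K R) (H i) /
              NewtonPuiseux.evalAt R (H i)) := by
  have : CharZero L := charZero_of_injective_algebraMap (algebraMap K L).injective
  have he0 : e ≠ 0 := he.ne'
  have heL : (e : L) ≠ 0 := Nat.cast_ne_zero.2 he0
  have hr : algebraMap K L (PowerSeries.constantCoeff R) ≠ 0 := by simpa using hR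
  have hconst := NewtonPuiseux.constantCoeff_map (algebraMap K L) R
  obtain ⟨ρ, σ, hRρ, hρ, hσ, h, h'⟩ :=
    NewtonPuiseux.exists_eq_C_mul_pow_and_subst_eq
      (R := PowerSeries.map (algebraMap K L) R) he0 (hconst ▸ hr)
  have hρ0 : PowerSeries.constantCoeff ρ ≠ 0 := hρ ▸ one_ne_zero
  rw [hconst] at hRρ
  refine ⟨fun _ => NewtonPuiseux.ncard_solutions heL hr hRρ hρ0 h h', fun H hinj hH => ?_⟩
  choose c hc hcH using fun i =>
    (NewtonPuiseux.mem_solutions_iff heL hr hRρ hρ0 h h').1 (hH i)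
  have hcinj : Function.Injective c := fun i j hij => hinj (by rw [← hcH, ← hcH, hij])
  simp only [NewtonPuiseux.toHahn, NewtonPuiseux.evalAt, NewtonPuiseux.map_G,
    ← NewtonPuiseux.derivative_map, hRρ]
  exact NewtonPuiseux.ofPowerSeries_G_eq (Fintype.card_fin e) he0 hr hσ h hcinj hc hcH
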